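/- Let $G$ be a finite simple graph on the vertex set $V=\{x_1,\dots,x_n\}$, let $\mathbf k$ be a field and $R=\mathbf k[x_1,\dots,x_n]$ with the standard grading. The closed neighborhood ideal of $G$ is $$NI(G)=\Big\langle \prod_{x_j\in N[x_i]}x_j \ :\ x_i\in V\Big\rangle\subseteq R,\qquad N[x_i]=\{x_i\}\cup\{x_j : \{x_i,x_j\}\in E(G)\}.$$ Put $V_1(G)=\{x\in V:\deg_G(x)=1\}$, $V'_1(G)=\{x\in V_1(G): N_G(x)\subseteq V_1(G)\}$, $$V_2(G)=\{x\in V:\deg_G(x)\ge 2,\ N_G(x)\cap V_1(G)\ne\emptyset\},\qquad V_3(G)=\{x\in V:\deg_G(x)\ge 2,\ N_G(x)\cap V_1(G)=\emptyset\},$$ where $N_G(x)$ is the set of neighbours of $x$. Let $a_G$ be the matching number of $G$, that is, the maximum size of a set of pairwise disjoint edges of $G$. Assume that $V_3(G)$ is an independent set of $G$. Then (i) $a_G=|V_2(G)|+\tfrac12|V'_1(G)|$; (ii) $\operatorname{reg}(R/NI(G))=a_G$, where $\operatorname{reg}$ is the Castelnuovo–Mumford regularity, $\operatorname{reg}(M)=\max\{j-i:\beta_{i,j}(M)\neq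 0\}$, and $\beta_{i,j}(M)$ is the number of summands $R(-j)$ in homological degree $i$ of the minimal graded free resolution of $M$; (iii) $\operatorname{pd}(R/NI(G))=\operatorname{bight}(NI(G))=n-a_G$, where $\operatorname{pd}$ is the projective dimension over $R$ and $\operatorname{bight}(I)$ is the maximum of the heights of the minimal primes of $I$. -/

import Mathlib

noncomputable section

namespace ClosedNbhd

/-! ### Graph invariants -/

section Graph

variable {V : Type*}

/-- A matching: a set of edges of `G`, any two distinct members of which share no vertex. -/
def IsEdgeMatching (G : SimpleGraph V) (M : Finset (Sym2 V)) : Prop :=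
  (∀ e ∈ M, e ∈ G.edgeSet) ∧ ∀ e ∈ M, ∀ f ∈ M, e ≠ f → ∀ v : V, ¬ (v ∈ e ∧ v ∈ f)

/-- The matching number `a_G`: the maximal size of a matching. -/
def matchingNumber (G : SimpleGraph V) : ℕ :=
  sSup {m : ℕ | ∃ M : Finset (Sym2 V), IsEdgeMatching G M ∧ M.card = m}

/-- The degree of a vertex (of a finite graph). -/
def deg (G : SimpleGraph V) (x : V) : ℕ := (G.neighborSet x).ncard

/-- The set of leaves, the vertices of degree one. -/
def V₁ (G : SimpleGraph V) : Set V := {x | deg G x = 1}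

/-- The leaves all of whose neighbours are leaves. -/
def V₁' (G : SimpleGraph V) : Set V := {x | x ∈ V₁ G ∧ G.neighborSet x ⊆ V₁ G}

/-- The vertices of degree at least two that have a leaf as a neighbour. -/
def V₂ (G : SimpleGraph V) : Set V := {x | 2 ≤ deg G x ∧ (G.neighborSet x ∩ V₁ G).Nonempty}

/-- The vertices of degree at least two that have no leaf as a neighbour. -/
def V₃ (G : SimpleGraph V) : Set V := {x | 2 ≤ deg G x ∧ G.neighborSet x ∩ V₁ G = ∅}

end Graph

/-! ### The closed neighborhood ideal -/

open Classical in
/-- The closed neighborhood `N[x]` of a vertex. -/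
def closedNbhd {V : Type*} [Fintype V] (G : SimpleGraph V) (x : V) : Finset V :=
  Finset.univ.filter fun y => y = x ∨ G.Adj x y

/-- The closed neighborhood ideal `NI(G)` in the polynomial ring over `k` whose variables are the
vertices of `G`. -/
def NI (k : Type*) [Field k] {V : Type*} [Fintype V] (G : SimpleGraph V) :
    Ideal (MvPolynomial V k) :=
  Ideal.span (Set.range fun x : V => ∏ y ∈ closedNbhd G x, MvPolynomial.X y)

/-- The big height of an ideal: the supremum of the heights of its minimal primes (a maximum in a
Noetherian ring, for a proper ideal). -/
def bigHeight {R : Type*} [CommRing R] (I : Ideal R) : ℕ∞ :=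
  ⨆ P ∈ I.minimalPrimes, P.height

/-! ### Graded free resolutions and Castelnuovo-Mumford regularity -/

section Resolution

variable {k : Type*} [Field k] {σ : Type*}

/-- A graded free resolution `⋯ → F₁ → F₀ → M → 0`, by graded free modules of finite rank, of a
module `M` over the standard graded polynomial ring `R = k[σ]`, where `𝓜 j` is the component of
degree `j` of `M`. The module `F_i` is `⨁_b R(-deg i b)`, with one summand for each index `b` of a
finite type `B i`, and all the maps preserve degrees. -/
structure GradedFreeResolution {M : Type*} [AddCommGroup M] [Module (MvPolynomial σ k) M]
    (𝓜 : ℕ → AddSubgroup M) where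
  /-- the index type of the homogeneous basis of `F_i` -/
  B : ℕ → Type
  finite_B : ∀ i, Finite (B i)
  /-- the degrees of the basis elements -/
  deg : ∀ i, B i → ℕ
  /-- the differentials `F_{i+1} → F_i` -/
  d : ∀ i, (B (i + 1) →₀ MvPolynomial σ k) →ₗ[MvPolynomial σ k] (B i →₀ MvPolynomial σ k)
  /-- the augmentation `F₀ → M` -/
  ε : (B 0 →₀ MvPolynomial σ k) →ₗ[MvPolynomial σ k] M
  /-- the matrix entry of `d i` at `(b, c)` is zero or homogeneous of degree `deg c - deg b ≥ 0` -/
  d_homogeneous : ∀ i (c : B (i + 1)) (b : B i), d i (Finsupp.single c 1) b = 0 ∨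
    ∃ m : ℕ, deg i b + m = deg (i + 1) c ∧ (d i (Finsupp.single c 1) b).IsHomogeneous m
  ε_homogeneous : ∀ b : B 0, ε (Finsupp.single b 1) ∈ 𝓜 (deg 0 b)
  ε_surjective : Function.Surjective ε
  exact_zero : Function.Exact (d 0) ε
  exact_succ : ∀ i, Function.Exact (d (i + 1)) (d i)

variable {M : Type*} [AddCommGroup M] [Module (MvPolynomial σ k) M] {𝓜 : ℕ → AddSubgroup M}

/-- A graded free resolution is minimal if each differential maps `F_{i+1}` into `𝔪 F_i`, where
`𝔪` is the ideal generated by the variables; that is, if all the matrix entries of the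
differentials have constant coefficient zero. -/
def GradedFreeResolution.IsMinimal (F : GradedFreeResolution (k := k) (σ := σ) 𝓜) : Prop :=
  ∀ i (c : F.B (i + 1)) (b : F.B i),
    MvPolynomial.constantCoeff (F.d i (Finsupp.single c 1) b) = 0

/-- The number of summands `R(-j)` of `F_i`; for a minimal resolution this is the graded Betti
number `β_{i,j}`. -/
def GradedFreeResolution.betti (F : GradedFreeResolution (k := k) (σ := σ) 𝓜) (i j : ℕ) : ℕ :=
  Nat.card {b : F.B i // F.deg i b = j}

variable (k σ 𝓜) in
/-- The Castelnuovo-Mumford regularity of a finitely generated graded module: the supremum of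
`j - i` over all `i`, `j` with `β_{i,j} ≠ 0`, where the Betti numbers are read off from minimal
graded free resolutions. -/
def regularity : EReal :=
  sSup {r : EReal | ∃ F : GradedFreeResolution (k := k) (σ := σ) 𝓜, F.IsMinimal ∧
    ∃ i j : ℕ, F.betti i j ≠ 0 ∧ r = (((j : ℝ) - (i : ℝ) : ℝ) : EReal)}

/-- The grading of `R ⧸ I` induced by the standard grading of the polynomial ring `R`: the
component of degree `j` consists of the classes of the homogeneous polynomials of degree `j`. -/
def quotientGrading (I : Ideal (MvPolynomial σ k)) (j : ℕ) : AddSubgroup (MvPolynomial σ k ⧸ I) :=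
  (MvPolynomial.homogeneousSubmodule σ k j).toAddSubgroup.map
    (Ideal.Quotient.mk I).toAddMonoidHom

end Resolution

end ClosedNbhd

end

noncomputable section

namespace ClosedNbhd

/-! ### Comparison of graded free resolutions -/

section Comparison

open MvPolynomial

/-! Let S consist of `V₂ G` and one end of each component with two vertices. Since `V₃ G` is
independent, S is a vertex cover, and every s in S has a leaf outside S whose only neighbour is s.
Edges to these leaves form a matching of size |S|, and a cover bounds every matching, so the
matching number is |S|.

The leaf at s has its closed neighborhood inside N[s], so the vertices outside S already give
generators of the ideal. They are pairwise nonadjacent, so each x outside S occurs in the generator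
of x and in no other. With such private variables, dropping a generator always shrinks a least
common multiple: the Taylor resolution is minimal. Its length is n - |S|. The lcm of i generators
has degree at most i + |S|, with equality for all of them together, which gives the regularity
(`regularity_monomialIdeal`, `projectiveDimension_monomialIdeal`). The private variables generate a
minimal prime of height n - |S|, and Krull's height theorem bounds the other heights
(`bigHeight_monomialIdeal`).

Regularity quantifies over all minimal resolutions, so `betti_ne_zero` compares an arbitrary one
with Taylor's. -/

lemma exists_dependent_seq {α : ℕ → Type*} (Q : ∀ i, α i → Prop) (S : ∀ i, α i → α (i + 1) → Prop)
    (a₀ : α 0) (h₀ : Q 0 a₀) (hs : ∀ i a, Q i a → ∃ b, Q (i + 1) b ∧ S i a b) :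
    ∃ a : ∀ i, α i, a 0 = a₀ ∧ (∀ i, Q i (a i)) ∧ ∀ i, S i (a i) (a (i + 1)) := by
  choose next hQ hS using hs
  let s : ∀ i, {a : α i // Q i a} := fun i =>
    Nat.rec ⟨a₀, h₀⟩ (fun i a => ⟨next i a.1 a.2, hQ i a.1 a.2⟩) i
  exact ⟨fun i => (s i).1, rfl, fun i => (s i).2, fun i => hS i (s i).1 (s i).2⟩

lemma exists_comp_eq_of_range_le {R P Q N : Type*} [Ring R] [AddCommGroup P] [Module R P]
    [Module.Projective R P] [AddCommGroup Q] [Module R Q] [AddCommGroup N] [Module R N]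
    (f : P →ₗ[R] N) (d : Q →ₗ[R] N) (h : LinearMap.range f ≤ LinearMap.range d) :
    ∃ g : P →ₗ[R] Q, d ∘ₗ g = f := by
  obtain ⟨g, hg⟩ := Module.projective_lifting_property d.rangeRestrict
    (f.codRestrict (LinearMap.range d) fun x => h ⟨x, rfl⟩) d.surjective_rangeRestrict
  refine ⟨g, LinearMap.ext fun x => ?_⟩
  exact congrArg Subtype.val (LinearMap.congr_fun hg x)

variable {k : Type*} [Field k] {σ : Type*}

/-- Modulo the ideal of the variables, a linear map acts through the matrix of its constant terms.
-/
lemma constantCoeff_apply_eq_sum {B C : Type*}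
    (f : (B →₀ MvPolynomial σ k) →ₗ[MvPolynomial σ k] (C →₀ MvPolynomial σ k))
    (x : B →₀ MvPolynomial σ k) (c : C) :
    constantCoeff (f x c) =
      x.sum fun b p => constantCoeff p * constantCoeff (f (Finsupp.single b 1) c) := by
  conv_lhs => rw [← Finsupp.sum_single x]
  rw [Finsupp.sum, map_sum, Finsupp.finsetSum_apply, map_sum, Finsupp.sum]
  refine Finset.sum_congr rfl fun b _ => ?_
  rw [← map_mul, ← smul_eq_mul, ← Finsupp.smul_apply, ← map_smul, Finsupp.smul_single,
    smul_eq_mul, mul_one]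

/-- Homogeneity of degree `n` in the graded free module with basis elements of degrees `deg b`. -/
def IsHomogeneousVec {B : Type*} (deg : B → ℕ) (n : ℕ) (x : B →₀ MvPolynomial σ k) : Prop :=
  ∀ b, x b = 0 ∨ ∃ m : ℕ, deg b + m = n ∧ (x b).IsHomogeneous m

/-- The component of degree `n` of a vector in a graded free module. -/
def vecComponent {B : Type*} (deg : B → ℕ) (n : ℕ) (x : B →₀ MvPolynomial σ k) :
    B →₀ MvPolynomial σ k :=
  Finsupp.onFinset x.support
    (fun b => if deg b ≤ n then homogeneousComponent (n - deg b) (x b) else 0) fun b hb => by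
      rw [Finsupp.mem_support_iff]
      rintro h
      simp [h] at hb

lemma vecComponent_apply {B : Type*} (deg : B → ℕ) (n : ℕ) (x : B →₀ MvPolynomial σ k) (b : B) :
    vecComponent deg n x b = if deg b ≤ n then homogeneousComponent (n - deg b) (x b) else 0 := rfl

lemma vecComponent_add {B : Type*} (deg : B → ℕ) (n : ℕ) (x y : B →₀ MvPolynomial σ k) :
    vecComponent deg n (x + y) = vecComponent deg n x + vecComponent deg n y := by
  ext1 b
  simp only [vecComponent_apply, Finsupp.add_apply]
  split_ifs <;> simp

lemma vecComponent_zero {B : Type*} (deg : B → ℕ) (n : ℕ) :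
    vecComponent deg n (0 : B →₀ MvPolynomial σ k) = 0 := by
  ext1 b
  simp [vecComponent_apply]

lemma isHomogeneousVec_vecComponent {B : Type*} (deg : B → ℕ) (n : ℕ)
    (x : B →₀ MvPolynomial σ k) : IsHomogeneousVec deg n (vecComponent deg n x) := by
  intro b
  rw [vecComponent_apply]
  split_ifs with h
  · exact Or.inr ⟨n - deg b, by omega, homogeneousComponent_isHomogeneous _ _⟩
  · exact Or.inl rfl

lemma IsHomogeneousVec.vecComponent_eq {B : Type*} {deg : B → ℕ} {n : ℕ}
    {x : B →₀ MvPolynomial σ k} (h : IsHomogeneousVec deg n x) (m : ℕ) :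
    vecComponent deg m x = if n = m then x else 0 := by
  ext1 b
  rw [vecComponent_apply]
  rcases h b with h | ⟨l, hl, hh⟩
  · rw [h]; split_ifs <;> simp [h]
  · rw [homogeneousComponent_of_mem ((mem_homogeneousSubmodule _ _).2 hh)]
    by_cases hnm : n = m
    · rw [if_pos (by omega), if_pos (by omega), if_pos hnm]
    · rw [if_neg hnm]
      split_ifs <;> first | rfl | omega

lemma isHomogeneousVec_smul {B : Type*} {deg : B → ℕ} {n m : ℕ} {x : B →₀ MvPolynomial σ k}
    (h : IsHomogeneousVec deg n x) {p : MvPolynomial σ k} (hp : p.IsHomogeneous m) :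
    IsHomogeneousVec deg (m + n) (p • x) := by
  intro b
  rw [Finsupp.smul_apply, smul_eq_mul]
  rcases h b with h | ⟨l, hl, hh⟩
  · exact Or.inl (by rw [h, mul_zero])
  · exact Or.inr ⟨m + l, by omega, hp.mul hh⟩

/-- A linear map of graded free modules that preserves degrees. -/
def IsGradedMap {B C : Type*} (degB : B → ℕ) (degC : C → ℕ)
    (f : (B →₀ MvPolynomial σ k) →ₗ[MvPolynomial σ k] (C →₀ MvPolynomial σ k)) : Prop :=
  ∀ b, IsHomogeneousVec degC (degB b) (f (Finsupp.single b 1))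

lemma isHomogeneousVec_add {B : Type*} {deg : B → ℕ} {n : ℕ} {x y : B →₀ MvPolynomial σ k}
    (hx : IsHomogeneousVec deg n x) (hy : IsHomogeneousVec deg n y) :
    IsHomogeneousVec deg n (x + y) := by
  have : x + y = vecComponent deg n (x + y) := by
    rw [vecComponent_add, hx.vecComponent_eq, hy.vecComponent_eq, if_pos rfl, if_pos rfl]
  rw [this]
  exact isHomogeneousVec_vecComponent _ _ _

lemma IsGradedMap.map_single {B C : Type*} {degB : B → ℕ} {degC : C → ℕ}
    {f : (B →₀ MvPolynomial σ k) →ₗ[MvPolynomial σ k] (C →₀ MvPolynomial σ k)}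
    (hf : IsGradedMap degB degC f) (b : B) {m : ℕ} {p : MvPolynomial σ k}
    (hp : p.IsHomogeneous m) : IsHomogeneousVec degC (m + degB b) (f (Finsupp.single b p)) := by
  have : Finsupp.single b p = p • Finsupp.single b (1 : MvPolynomial σ k) := by
    rw [Finsupp.smul_single, smul_eq_mul, mul_one]
  rw [this, map_smul]
  exact isHomogeneousVec_smul (hf b) hp

lemma IsGradedMap.map_vecComponent {B C : Type*} {degB : B → ℕ} {degC : C → ℕ}
    {f : (B →₀ MvPolynomial σ k) →ₗ[MvPolynomial σ k] (C →₀ MvPolynomial σ k)}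
    (hf : IsGradedMap degB degC f) (n : ℕ) (x : B →₀ MvPolynomial σ k) :
    f (vecComponent degB n x) = vecComponent degC n (f x) := by
  induction x using Finsupp.induction_linear with
  | zero => simp [vecComponent_zero]
  | add x y hx hy => rw [vecComponent_add, map_add, map_add, vecComponent_add, hx, hy]
  | single b p =>
    -- By additivity it is enough to treat a homogeneous coefficient, where both sides are either
    -- zero or the full image.
    have key : ∀ m q, q.IsHomogeneous m → f (vecComponent degB n (Finsupp.single b q)) =
        vecComponent degC n (f (Finsupp.single b q)) := by
      intro m q hq
      have h1 : IsHomogeneousVec degB (m + degB b) (Finsupp.single b q) := by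
        intro c
        by_cases h : b = c
        · subst h
          exact Or.inr ⟨m, by omega, by simpa using hq⟩
        · exact Or.inl (by simp [h])
      rw [h1.vecComponent_eq, (hf.map_single b hq).vecComponent_eq]
      split_ifs <;> simp
    rw [← sum_homogeneousComponent p]
    generalize Finset.range (p.totalDegree + 1) = s
    induction s using Finset.induction_on with
    | empty => simp [vecComponent_zero]
    | insert i s hi ih =>
      rw [Finset.sum_insert hi, Finsupp.single_add, vecComponent_add, map_add, map_add,
        vecComponent_add, ih, key i _ (homogeneousComponent_isHomogeneous _ _)]

lemma IsGradedMap.isHomogeneousVec_apply {B C : Type*} {degB : B → ℕ} {degC : C → ℕ}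
    {f : (B →₀ MvPolynomial σ k) →ₗ[MvPolynomial σ k] (C →₀ MvPolynomial σ k)}
    (hf : IsGradedMap degB degC f) {n : ℕ} {x : B →₀ MvPolynomial σ k}
    (hx : IsHomogeneousVec degB n x) : IsHomogeneousVec degC n (f x) := by
  have h := hf.map_vecComponent n x
  rw [hx.vecComponent_eq, if_pos rfl] at h
  rw [h]
  exact isHomogeneousVec_vecComponent _ _ _

lemma IsGradedMap.deg_eq_of_constantCoeff_ne_zero {B C : Type*} {degB : B → ℕ} {degC : C → ℕ}
    {f : (B →₀ MvPolynomial σ k) →ₗ[MvPolynomial σ k] (C →₀ MvPolynomial σ k)}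
    (hf : IsGradedMap degB degC f) {b : B} {c : C}
    (h : constantCoeff (f (Finsupp.single b 1) c) ≠ 0) : degC c = degB b := by
  rcases hf b c with h0 | ⟨m, hm, hh⟩
  · simp [h0] at h
  · have : m = 0 := by
      by_contra hne
      refine h ?_
      rw [constantCoeff_eq]
      exact hh.coeff_eq_zero (by simpa using Ne.symm hne)
    omega

namespace GradedFreeResolution

variable {M : Type*} [AddCommGroup M] [Module (MvPolynomial σ k) M] {𝓜 : ℕ → AddSubgroup M}
  (F T : GradedFreeResolution (k := k) (σ := σ) 𝓜)

/-- The module of cycles in homological degree `i`, with respect to the augmented complex. -/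
def cycles : ∀ i, Submodule (MvPolynomial σ k) (F.B i →₀ MvPolynomial σ k)
  | 0 => LinearMap.ker F.ε
  | i + 1 => LinearMap.ker (F.d i)

lemma range_d (i : ℕ) : LinearMap.range (F.d i) = F.cycles i := by
  cases i with
  | zero => exact (LinearMap.exact_iff.1 F.exact_zero).symm
  | succ i => exact (LinearMap.exact_iff.1 (F.exact_succ i)).symm

lemma d_d (i : ℕ) (x) : F.d i (F.d (i + 1) x) = 0 := (F.exact_succ i _).2 ⟨x, rfl⟩

lemma mem_cycles_succ {i : ℕ} {x} : x ∈ F.cycles (i + 1) ↔ F.d i x = 0 := Iff.rfl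

lemma isGradedMap_d (i : ℕ) : IsGradedMap (F.deg (i + 1)) (F.deg i) (F.d i) :=
  fun c b => F.d_homogeneous i c b

lemma d_mem_cycles (i : ℕ) (x) : F.d i x ∈ F.cycles i := by
  rw [← range_d]; exact ⟨x, rfl⟩

lemma exists_chainMap : ∃ f : ∀ i, (F.B i →₀ MvPolynomial σ k) →ₗ[MvPolynomial σ k]
    (T.B i →₀ MvPolynomial σ k), T.ε ∘ₗ f 0 = F.ε ∧
      ∀ i, T.d i ∘ₗ f (i + 1) = f i ∘ₗ F.d i := by
  obtain ⟨f₀, hf₀⟩ := exists_comp_eq_of_range_le F.ε T.ε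
    (by rw [LinearMap.range_eq_top.2 T.ε_surjective]; exact le_top)
  obtain ⟨f, rfl, -, hf⟩ := exists_dependent_seq
    (α := fun i => (F.B i →₀ MvPolynomial σ k) →ₗ[MvPolynomial σ k] (T.B i →₀ MvPolynomial σ k))
    (fun i f => ∀ x ∈ F.cycles i, f x ∈ T.cycles i)
    (fun i f g => T.d i ∘ₗ g = f ∘ₗ F.d i) f₀
    (fun x hx => by
      change T.ε (f₀ x) = 0
      rw [← LinearMap.comp_apply, hf₀]; exact hx)
    (fun i f hf => by
      obtain ⟨g, hg⟩ := exists_comp_eq_of_range_le (f ∘ₗ F.d i) (T.d i) (by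
        rw [T.range_d]
        rintro _ ⟨x, rfl⟩
        exact hf _ (F.d_mem_cycles i x))
      refine ⟨g, fun x hx => ?_, hg⟩
      rw [mem_cycles_succ, ← LinearMap.comp_apply, hg, LinearMap.comp_apply,
        F.mem_cycles_succ.1 hx, map_zero])
  exact ⟨f, hf₀, hf⟩

/-- The family `𝓜` is arbitrary, so homogeneous lifting along `T.ε` has to be assumed as `hT`. In
higher degrees it is automatic: a component of any preimage is again a preimage. -/
lemma exists_gradedChainMap
    (hT : ∀ n, ∀ z ∈ 𝓜 n, ∃ y, IsHomogeneousVec (T.deg 0) n y ∧ T.ε y = z) :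
    ∃ f : ∀ i, (F.B i →₀ MvPolynomial σ k) →ₗ[MvPolynomial σ k]
    (T.B i →₀ MvPolynomial σ k), T.ε ∘ₗ f 0 = F.ε ∧
      (∀ i, T.d i ∘ₗ f (i + 1) = f i ∘ₗ F.d i) ∧ ∀ i, IsGradedMap (F.deg i) (T.deg i) (f i) := by
  choose y hy hεy using fun b => hT _ _ (F.ε_homogeneous b)
  have hf₀ : T.ε ∘ₗ Finsupp.linearCombination (MvPolynomial σ k) y = F.ε := by
    ext b; simp [hεy]
  obtain ⟨f, h₀, hQ, hf⟩ := exists_dependent_seq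
    (α := fun i => (F.B i →₀ MvPolynomial σ k) →ₗ[MvPolynomial σ k] (T.B i →₀ MvPolynomial σ k))
    (fun i f => (∀ x ∈ F.cycles i, f x ∈ T.cycles i) ∧ IsGradedMap (F.deg i) (T.deg i) f)
    (fun i f g => T.d i ∘ₗ g = f ∘ₗ F.d i) (Finsupp.linearCombination (MvPolynomial σ k) y)
    ⟨fun x hx => by
      change T.ε (_) = 0
      rw [← LinearMap.comp_apply, hf₀]; exact hx,
      fun b => by simpa using hy b⟩
    (fun i f hf => by
      have hex : ∀ c, ∃ z, IsHomogeneousVec (T.deg (i + 1)) (F.deg (i + 1) c) z ∧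
          T.d i z = f (F.d i (Finsupp.single c 1)) := by
        intro c
        have : f (F.d i (Finsupp.single c 1)) ∈ LinearMap.range (T.d i) := by
          rw [T.range_d]
          exact hf.1 _ (F.d_mem_cycles i _)
        obtain ⟨w, hw⟩ := this
        refine ⟨_, isHomogeneousVec_vecComponent _ _ w, ?_⟩
        rw [(T.isGradedMap_d i).map_vecComponent, hw,
          (hf.2.isHomogeneousVec_apply (F.isGradedMap_d i c)).vecComponent_eq, if_pos rfl]
      choose z hz hdz using hex
      have hg : T.d i ∘ₗ Finsupp.linearCombination (MvPolynomial σ k) z = f ∘ₗ F.d i := by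
        ext1 c; ext1; simp [hdz]
      refine ⟨_, ⟨fun x hx => ?_, fun c => by simpa using hz c⟩, hg⟩
      rw [mem_cycles_succ, ← LinearMap.comp_apply, hg, LinearMap.comp_apply,
        F.mem_cycles_succ.1 hx, map_zero])
  exact ⟨f, by rw [h₀, hf₀], hf, fun i => (hQ i).2⟩

variable {F} in
lemma IsMinimal.constantCoeff_d (hF : F.IsMinimal) (i : ℕ) (x) (b : F.B i) :
    constantCoeff (F.d i x b) = 0 := by
  rw [constantCoeff_apply_eq_sum]
  exact Finset.sum_eq_zero fun c _ => by simp only [hF i c b, mul_zero]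

variable {F} in
/-- An endomorphism of a minimal resolution that lifts zero has all its entries in the maximal
homogeneous ideal. -/
lemma IsMinimal.constantCoeff_eq_zero_of_lift_zero (hF : F.IsMinimal)
    (g : ∀ i, (F.B i →₀ MvPolynomial σ k) →ₗ[MvPolynomial σ k] (F.B i →₀ MvPolynomial σ k))
    (h₀ : F.ε ∘ₗ g 0 = 0) (hg : ∀ i, F.d i ∘ₗ g (i + 1) = g i ∘ₗ F.d i) (i : ℕ) (b c : F.B i) :
    constantCoeff (g i (Finsupp.single b 1) c) = 0 := by
  obtain ⟨s₀, hs₀⟩ := exists_comp_eq_of_range_le (g 0) (F.d 0) (by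
    rw [F.range_d]
    rintro _ ⟨x, rfl⟩
    exact LinearMap.congr_fun h₀ x)
  have hg' : ∀ i x, F.d i (g (i + 1) x) = g i (F.d i x) := fun i => LinearMap.congr_fun (hg i)
  -- A null homotopy g = ds + sd is built degree by degree; the invariant dsd = dg says that g - sd
  -- takes values in cycles, so the next step can be lifted. By minimality both ds and sd have
  -- entries without constant term.
  obtain ⟨s, rfl, -, hs⟩ := exists_dependent_seq
    (α := fun i => (F.B i →₀ MvPolynomial σ k) →ₗ[MvPolynomial σ k]
      (F.B (i + 1) →₀ MvPolynomial σ k))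
    (fun i s => ∀ x, F.d i (s (F.d i x)) = F.d i (g (i + 1) x))
    (fun i s s' => ∀ x, F.d (i + 1) (s' x) = g (i + 1) x - s (F.d i x)) s₀
    (fun x => by rw [← LinearMap.comp_apply (F.d 0) s₀, hs₀, hg'])
    (fun i s hs => by
      obtain ⟨s', hs'⟩ := exists_comp_eq_of_range_le (g (i + 1) - s ∘ₗ F.d i) (F.d (i + 1)) (by
        rw [F.range_d]
        rintro _ ⟨x, rfl⟩
        rw [F.mem_cycles_succ, LinearMap.sub_apply, map_sub, LinearMap.comp_apply, hs, sub_self])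
      have hs'' : ∀ x, F.d (i + 1) (s' x) = g (i + 1) x - s (F.d i x) := LinearMap.congr_fun hs'
      exact ⟨s', fun x => by rw [hs'', F.d_d, map_zero, sub_zero, hg'], hs''⟩)
  cases i with
  | zero => rw [← hs₀]; exact hF.constantCoeff_d _ _ _
  | succ i =>
    rw [eq_add_of_sub_eq (hs i _).symm, Finsupp.add_apply, map_add,
      hF.constantCoeff_d, zero_add, constantCoeff_apply_eq_sum]
    exact Finset.sum_eq_zero fun e _ => by simp only [hF.constantCoeff_d, zero_mul]

variable {F} in
/-- The nonzero Betti numbers of a minimal resolution are nonzero in every resolution. -/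
theorem IsMinimal.betti_ne_zero (hF : F.IsMinimal)
    (hT : ∀ n, ∀ z ∈ 𝓜 n, ∃ y, IsHomogeneousVec (T.deg 0) n y ∧ T.ε y = z) {i j : ℕ}
    (h : F.betti i j ≠ 0) : T.betti i j ≠ 0 := by
  obtain ⟨φ, hφ₀, hφ, hgr⟩ := F.exists_gradedChainMap T hT
  obtain ⟨ψ, hψ₀, hψ⟩ := T.exists_chainMap F
  obtain ⟨⟨b, hb⟩⟩ : Nonempty {b : F.B i // F.deg i b = j} := (Nat.card_ne_zero.1 h).1
  -- The map id - ψφ lifts zero, so the diagonal entry of ψφ at b has constant term 1. Some entry of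
  -- φ in column b is then a unit modulo the variables, and its row has the same degree as b. Only φ
  -- needs to be graded.
  have key := hF.constantCoeff_eq_zero_of_lift_zero
    (fun i => LinearMap.id - ψ i ∘ₗ φ i)
    (by rw [LinearMap.comp_sub, ← LinearMap.comp_assoc, hψ₀, hφ₀, LinearMap.comp_id, sub_self])
    (fun i => by
      rw [LinearMap.comp_sub, ← LinearMap.comp_assoc, hψ, LinearMap.comp_assoc, hφ,
        ← LinearMap.comp_assoc, LinearMap.sub_comp]; rfl) i b b
  rw [LinearMap.sub_apply, Finsupp.sub_apply, map_sub, LinearMap.id_apply, Finsupp.single_eq_same,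
    map_one, sub_eq_zero, LinearMap.comp_apply, constantCoeff_apply_eq_sum] at key
  obtain ⟨c, -, hc⟩ := Finset.exists_ne_zero_of_sum_ne_zero (key ▸ one_ne_zero : _ ≠ (0 : k))
  have := T.finite_B i
  exact Nat.card_ne_zero.2 ⟨⟨⟨c, ((hgr i).deg_eq_of_constantCoeff_ne_zero
    (left_ne_zero_of_mul hc)).trans hb⟩⟩, inferInstance⟩

end GradedFreeResolution

end Comparison

/-! ### The projective dimension read off from a minimal resolution -/

namespace GradedFreeResolution

open CategoryTheory MvPolynomial

universe u v

variable {k : Type u} [Field k] {σ : Type v}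
variable {M : Type max u v} [AddCommGroup M] [Module (MvPolynomial σ k) M]
  {𝓜 : ℕ → AddSubgroup M} (F : GradedFreeResolution (k := k) (σ := σ) 𝓜)

/-- The cokernel of `F_{i+1} → F_i`, which is the `i`-th syzygy module. -/
abbrev syzygy (i : ℕ) : Type max u v := (F.B i →₀ MvPolynomial σ k) ⧸ F.cycles i

/-- The `(i+1)`-st syzygy module is the module of cycles in degree `i`. -/
def syzygySuccEquiv (i : ℕ) : F.syzygy (i + 1) ≃ₗ[MvPolynomial σ k]
    LinearMap.ker (F.cycles i).mkQ :=
  (F.d i).quotKerEquivRange.trans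
    (LinearEquiv.ofEq _ _ (by rw [Submodule.ker_mkQ, F.range_d]))

lemma shortExact_syzygy (i : ℕ) : (F.cycles i).mkQ.shortComplexKer.ShortExact :=
  LinearMap.shortExact_shortComplexKer (F.cycles i).mkQ_surjective

lemma projective_term (i : ℕ) :
    Projective (ModuleCat.of (MvPolynomial σ k) (F.B i →₀ MvPolynomial σ k)) :=
  (IsProjective.iff_projective _).1 inferInstance

/-- Dimension shifting along 0 → Ω^{i+1} → F_i → Ω^i → 0. -/
lemma hasProjectiveDimensionLT_syzygy_of_succ {i n : ℕ}
    (h : HasProjectiveDimensionLT (ModuleCat.of (MvPolynomial σ k) (F.syzygy (i + 1))) n) :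
    HasProjectiveDimensionLT (ModuleCat.of (MvPolynomial σ k) (F.syzygy i)) (n + 1) := by
  have := F.projective_term i
  exact (F.shortExact_syzygy i).hasProjectiveDimensionLT_X₃ n
    (hasProjectiveDimensionLT_of_iso (F.syzygySuccEquiv i).toModuleIso n)
    (hasProjectiveDimensionLT_of_ge _ 1 _ (by omega))

lemma hasProjectiveDimensionLT_syzygy_succ {i n : ℕ}
    (h : HasProjectiveDimensionLT (ModuleCat.of (MvPolynomial σ k) (F.syzygy i)) (n + 2)) :
    HasProjectiveDimensionLT (ModuleCat.of (MvPolynomial σ k) (F.syzygy (i + 1))) (n + 1) := by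
  have := ((F.shortExact_syzygy i).hasProjectiveDimensionLT_X₃_iff n (F.projective_term i)).1 h
  let e : ModuleCat.of (MvPolynomial σ k) (F.syzygy (i + 1)) ≅
      (F.cycles i).mkQ.shortComplexKer.X₁ := (F.syzygySuccEquiv i).toModuleIso
  exact hasProjectiveDimensionLT_of_iso e.symm _

lemma hasProjectiveDimensionLT_syzygy (i n : ℕ) (h : IsEmpty (F.B (i + n))) :
    HasProjectiveDimensionLT (ModuleCat.of (MvPolynomial σ k) (F.syzygy i)) n := by
  induction n generalizing i with
  | zero =>
    have : IsEmpty (F.B i) := h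
    have : Subsingleton (F.syzygy i) := (F.cycles i).mkQ_surjective.subsingleton
    exact (ModuleCat.isZero_of_subsingleton _).hasProjectiveDimensionLT_zero
  | succ n ih =>
    exact F.hasProjectiveDimensionLT_syzygy_of_succ (ih (i + 1) (by rwa [add_right_comm]))

lemma projective_syzygy {i n : ℕ}
    (h : HasProjectiveDimensionLT (ModuleCat.of (MvPolynomial σ k) (F.syzygy i)) (n + 1)) :
    Module.Projective (MvPolynomial σ k) (F.syzygy (i + n)) := by
  induction n generalizing i with
  | zero => exact (IsProjective.iff_projective _).2 (projective_iff_hasProjectiveDimensionLT_one.2 h)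
  | succ n ih =>
    have := ih (F.hasProjectiveDimensionLT_syzygy_succ h)
    rwa [add_right_comm, add_assoc] at this

variable {F} in
lemma IsMinimal.single_notMem_cycles (hF : F.IsMinimal) (i : ℕ) (b : F.B i) :
    Finsupp.single b 1 ∉ F.cycles i := by
  rw [← F.range_d]
  rintro ⟨x, hx⟩
  have := hF.constantCoeff_d i x b
  simp [hx] at this

variable {F} in
lemma IsMinimal.isEmpty_of_projective (hF : F.IsMinimal) {i : ℕ}
    (h : Module.Projective (MvPolynomial σ k) (F.syzygy i)) : IsEmpty (F.B (i + 1)) := by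
  refine ⟨fun b => ?_⟩
  obtain ⟨s, hs⟩ := Module.projective_lifting_property (F.cycles i).mkQ LinearMap.id
    (F.cycles i).mkQ_surjective
  -- A splitting s of F_i → Ω^i gives the projection of F_i onto the image of d; r lifts it to
  -- F_{i+1}, so that d r d = d.
  obtain ⟨r, hr⟩ := exists_comp_eq_of_range_le (LinearMap.id - s ∘ₗ (F.cycles i).mkQ) (F.d i) (by
    rw [F.range_d]
    rintro _ ⟨x, rfl⟩
    refine (Submodule.Quotient.mk_eq_zero _).1 ?_
    rw [← Submodule.mkQ_apply, LinearMap.sub_apply, map_sub, sub_eq_zero]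
    exact (LinearMap.congr_fun hs ((F.cycles i).mkQ x)).symm)
  -- The basis vector differs from r d b by a boundary. By minimality neither term has a constant
  -- coefficient at b, yet the basis vector has 1 there.
  have h1 : Finsupp.single b 1 - r (F.d i (Finsupp.single b 1)) ∈ F.cycles (i + 1) := by
    have h2 := LinearMap.congr_fun hr (F.d i (Finsupp.single b 1))
    have h3 : (F.cycles i).mkQ (F.d i (Finsupp.single b 1)) = 0 := by
      rw [← LinearMap.mem_ker, Submodule.ker_mkQ]
      exact F.d_mem_cycles i _
    rw [LinearMap.sub_apply, LinearMap.comp_apply, LinearMap.comp_apply, h3, map_zero,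
      sub_zero] at h2
    rw [F.mem_cycles_succ, map_sub, h2, LinearMap.id_apply, sub_self]
  rw [← F.range_d] at h1
  obtain ⟨x, hx⟩ := h1
  have h4 := hF.constantCoeff_d (i + 1) x b
  rw [hx, Finsupp.sub_apply, Finsupp.single_eq_same, map_sub, map_one,
    constantCoeff_apply_eq_sum, Finsupp.sum, Finset.sum_eq_zero, sub_zero] at h4
  · exact one_ne_zero h4
  · intro c _
    simp only [hF i b c, zero_mul]

/-- The zeroth syzygy module is the resolved module. -/
def syzygyZeroEquiv : F.syzygy 0 ≃ₗ[MvPolynomial σ k] M :=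
  F.ε.quotKerEquivOfSurjective F.ε_surjective

/-- The projective dimension is the length of a minimal graded free resolution. -/
theorem IsMinimal.projectiveDimension_eq {F : GradedFreeResolution (k := k) (σ := σ) 𝓜}
    (hF : F.IsMinimal) {n : ℕ} (hn : Nonempty (F.B n)) (hn' : IsEmpty (F.B (n + 1))) :
    projectiveDimension (ModuleCat.of (MvPolynomial σ k) M) = n := by
  rw [← projectiveDimension_eq_of_iso F.syzygyZeroEquiv.toModuleIso]
  refine le_antisymm ?_ ?_
  · rw [projectiveDimension_le_iff]
    exact F.hasProjectiveDimensionLT_syzygy 0 (n + 1) (by rwa [zero_add])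
  · rw [projectiveDimension_ge_iff]
    intro h
    obtain ⟨b⟩ := hn
    cases n with
    | zero =>
      rw [hasProjectiveDimensionLT_zero_iff_isZero, ModuleCat.isZero_iff_subsingleton] at h
      have : (F.cycles 0).mkQ (Finsupp.single b 1) = 0 := h.elim _ _
      rw [← LinearMap.mem_ker, Submodule.ker_mkQ] at this
      exact hF.single_notMem_cycles 0 b this
    | succ n =>
      have := F.projective_syzygy h
      rw [zero_add] at this
      exact (hF.isEmpty_of_projective this).false b

end GradedFreeResolution

/-! ### The Taylor resolution of a monomial ideal -/

namespace Taylor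

open MvPolynomial

/-- The sign of the face of `U` opposite to the vertex `t`. -/
def sign (k : Type*) [Field k] {ι : Type*} [LinearOrder ι] (U : Finset ι) (t : ι) : k :=
  (-1) ^ (U.filter (· < t)).card

/-! ### Signs of the faces of a simplex. -/

section Sign

variable {k : Type*} [Field k] {ι : Type*} [LinearOrder ι] {U : Finset ι} {s t : ι}

lemma sign_eq_one (h : ∀ u ∈ U, t ≤ u) : sign k U t = 1 := by
  rw [sign, Finset.filter_eq_empty_iff.2 fun u hu => not_lt.2 (h u hu), Finset.card_empty, pow_zero]

lemma sign_insert_of_lt (hs : s ∉ U) (hst : s < t) : sign k (insert s U) t = -sign k U t := by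
  rw [sign, sign, Finset.filter_insert, if_pos hst,
    Finset.card_insert_of_notMem fun h => hs (Finset.mem_filter.1 h).1, pow_succ, mul_neg_one]

lemma sign_insert_of_le (hst : t ≤ s) : sign k (insert s U) t = sign k U t := by
  rw [sign, sign, Finset.filter_insert, if_neg (not_lt.2 hst)]

lemma sign_erase_of_lt (hs : s ∈ U) (hst : s < t) : sign k (U.erase s) t = -sign k U t := by
  conv_rhs => rw [← Finset.insert_erase hs, sign_insert_of_lt (Finset.notMem_erase s U) hst,
    neg_neg]

lemma sign_erase_of_le (hs : s ∈ U) (hst : t ≤ s) : sign k (U.erase s) t = sign k U t := by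
  conv_rhs => rw [← Finset.insert_erase hs, sign_insert_of_le hst]

lemma sign_mul_sign_erase (hs : s ∈ U) (ht : t ∈ U) (hst : s ≠ t) :
    sign k U t * sign k (U.erase t) s + sign k U s * sign k (U.erase s) t = 0 := by
  rcases lt_or_gt_of_ne hst with h | h
  · rw [sign_erase_of_le ht h.le, sign_erase_of_lt hs h]; ring
  · rw [sign_erase_of_lt ht h, sign_erase_of_le hs h.le]; ring

end Sign

variable (k : Type*) [Field k] {σ : Type*} {ι : Type*} (e : ι → σ →₀ ℕ)

/-- The basis vector of `U`, multiplied by a monomial so as to have multidegree `α`. -/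
def vec (α : σ →₀ ℕ) (U : Finset ι) : Finset ι →₀ MvPolynomial σ k :=
  Finsupp.single U (monomial (α - U.sup e) 1)

lemma smul_single_eq_single_mul (p : MvPolynomial σ k) (U : Finset ι) (q : MvPolynomial σ k) :
    p • Finsupp.single U q = Finsupp.single U (p * q) := by
  rw [Finsupp.smul_single, smul_eq_mul]

lemma vec_sup (U : Finset ι) : vec k e (U.sup e) U = Finsupp.single U 1 := by
  rw [vec, tsub_self, monomial_zero', map_one]

variable {e} in
lemma monomial_smul_vec {α β : σ →₀ ℕ} {U : Finset ι} (hU : U.sup e ≤ β) :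
    monomial α (1 : k) • vec k e β U = vec k e (α + β) U := by
  rw [vec, smul_single_eq_single_mul, monomial_mul, one_mul, vec, ← add_tsub_assoc_of_le hU]

/-- Vectors supported on the sets with `i` elements. -/
def IsCard (i : ℕ) (x : Finset ι →₀ MvPolynomial σ k) : Prop := ∀ U, x U ≠ 0 → U.card = i

section IsCard

variable {k}

lemma IsCard.single {U : Finset ι} {i : ℕ} (h : U.card = i) (p : MvPolynomial σ k) :
    IsCard k i (Finsupp.single U p) := by
  intro W hW
  rw [← h]
  by_contra hne
  exact hW (Finsupp.single_eq_of_ne fun h => hne (by rw [h]))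

lemma IsCard.zero (i : ℕ) : IsCard k i (0 : Finset ι →₀ MvPolynomial σ k) :=
  fun _ h => absurd rfl h

lemma IsCard.add {i : ℕ} {x y : Finset ι →₀ MvPolynomial σ k} (hx : IsCard k i x)
    (hy : IsCard k i y) : IsCard k i (x + y) := by
  intro U hU
  by_cases h : x U = 0
  · exact hy U fun h' => hU (by rw [Finsupp.add_apply, h, h', add_zero])
  · exact hx U h

lemma IsCard.sum {α : Type*} {i : ℕ} (s : Finset α) (x : α → Finset ι →₀ MvPolynomial σ k)
    (h : ∀ a ∈ s, IsCard k i (x a)) : IsCard k i (∑ a ∈ s, x a) :=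
  Finset.sum_induction x (IsCard k i) (fun _ _ => IsCard.add) (IsCard.zero i) h

lemma IsCard.smul {S : Type*} [SMulZeroClass S (MvPolynomial σ k)] {i : ℕ}
    {x : Finset ι →₀ MvPolynomial σ k} (hx : IsCard k i x) (c : S) : IsCard k i (c • x) :=
  fun U hU => hx U fun h => hU (by rw [Finsupp.smul_apply, h, smul_zero])

end IsCard

variable [LinearOrder ι]

lemma sup_erase_le (U : Finset ι) (t : ι) : (U.erase t).sup e ≤ U.sup e :=
  Finset.sup_mono (U.erase_subset t)

/-- The differential of the Taylor complex, on the direct sum of all its terms. -/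
def diff : (Finset ι →₀ MvPolynomial σ k) →ₗ[MvPolynomial σ k] (Finset ι →₀ MvPolynomial σ k) :=
  Finsupp.linearCombination _ fun U => ∑ t ∈ U, sign k U t • vec k e (U.sup e) (U.erase t)

lemma diff_single_one (U : Finset ι) : diff k e (Finsupp.single U 1) =
    ∑ t ∈ U, sign k U t • vec k e (U.sup e) (U.erase t) := by
  rw [diff, Finsupp.linearCombination_single, one_smul]

variable {e} in
-- In a fixed multidegree the monomial coefficients disappear and the differential is the simplicial
-- boundary. The bound on `U.sup e` keeps the truncated subtraction in `vec` honest.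
lemma diff_vec {α : σ →₀ ℕ} {U : Finset ι} (hU : U.sup e ≤ α) :
    diff k e (vec k e α U) = ∑ t ∈ U, sign k U t • vec k e α (U.erase t) := by
  have : vec k e α U = monomial (α - U.sup e) (1 : k) • Finsupp.single U 1 := by
    rw [smul_single_eq_single_mul, mul_one, vec]
  rw [this, map_smul, diff_single_one, Finset.smul_sum]
  refine Finset.sum_congr rfl fun t _ => ?_
  rw [smul_comm, monomial_smul_vec k (sup_erase_le e U t), tsub_add_cancel_of_le hU]

lemma diff_diff (x) : diff k e (diff k e x) = 0 := by
  suffices diff k e ∘ₗ diff k e = 0 from LinearMap.congr_fun this x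
  ext1 U
  ext1
  simp only [LinearMap.comp_apply, Finsupp.lsingle_apply, LinearMap.zero_apply]
  rw [← vec_sup k e U, diff_vec k le_rfl, map_sum]
  have (t : ι) : diff k e (sign k U t • vec k e (U.sup e) (U.erase t)) =
      ∑ s ∈ U.erase t, (sign k U t * sign k (U.erase t) s) •
        vec k e (U.sup e) ((U.erase t).erase s) := by
    rw [LinearMap.map_smul_of_tower, diff_vec k (sup_erase_le e U t), Finset.smul_sum]
    simp only [smul_smul]
  simp only [this]
  rw [Finset.sum_sigma']
  -- Deleting two vertices in the opposite order gives the same face with the opposite sign.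
  refine Finset.sum_involution (fun p _ => ⟨p.2, p.1⟩) ?_ ?_ ?_ ?_
  · rintro ⟨t, s⟩ h
    simp only [Finset.mem_sigma, Finset.mem_erase] at h
    dsimp only
    rw [Finset.erase_right_comm (a := s) (b := t), ← add_smul,
      sign_mul_sign_erase h.2.2 h.1 h.2.1, zero_smul]
  · rintro ⟨t, s⟩ h - heq
    simp only [Finset.mem_sigma, Finset.mem_erase] at h
    exact h.2.1 (congrArg Sigma.fst heq)
  · rintro ⟨t, s⟩ h
    simp only [Finset.mem_sigma, Finset.mem_erase] at h ⊢
    exact ⟨h.2.2, h.2.1.symm, h.1⟩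
  · rintro ⟨t, s⟩ _
    rfl

/-! ### Exactness of the Taylor complex by a cone construction. -/

section Homotopy

variable [Fintype ι]

open Classical in
/-- The contracting homotopy on a basis vector of multidegree `α`: it inserts the first index
whose monomial divides `α`. -/
def contractVec (α : σ →₀ ℕ) (U : Finset ι) : Finset ι →₀ MvPolynomial σ k :=
  if h : (Finset.univ.filter fun t => e t ≤ α).Nonempty then
    if Finset.min' _ h ∈ U then 0 else vec k e α (insert (Finset.min' _ h) U)
  else 0

/-- The contracting homotopy of the Taylor complex. -/
def contract : (Finset ι →₀ MvPolynomial σ k) →ₗ[k] (Finset ι →₀ MvPolynomial σ k) :=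
  Finsupp.lsum k fun U => (basisMonomials σ k).constr k fun β => contractVec k e (β + U.sup e) U

variable {e} in
lemma contract_vec {α : σ →₀ ℕ} {U : Finset ι} (hU : U.sup e ≤ α) :
    contract k e (vec k e α U) = contractVec k e α U := by
  have : (monomial (α - U.sup e) (1 : k)) = basisMonomials σ k (α - U.sup e) := by
    rw [coe_basisMonomials]
  rw [contract, vec, Finsupp.lsum_single, this, Module.Basis.constr_basis,
    tsub_add_cancel_of_le hU]

variable {e} in
-- In multidegree α the complex is that of the full simplex on the indices t with `e t ≤ α`, a cone
-- over its least vertex m. Taking the least vertex makes the sign of m equal to 1. Nonemptiness of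
-- U ensures that m exists.
lemma diff_contract_vec {α : σ →₀ ℕ} {U : Finset ι} (hU : U.sup e ≤ α) (hne : U.Nonempty) :
    diff k e (contract k e (vec k e α U)) + contract k e (diff k e (vec k e α U)) =
      vec k e α U := by
  classical
  have hUα : ∀ u ∈ U, e u ≤ α := fun u hu => (Finset.le_sup hu).trans hU
  have h : (Finset.univ.filter fun t => e t ≤ α).Nonempty :=
    hne.mono fun u hu => Finset.mem_filter.2 ⟨Finset.mem_univ u, hUα u hu⟩
  obtain ⟨m, hm⟩ : ∃ m, m = Finset.min' _ h := ⟨_, rfl⟩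
  have hmα : e m ≤ α := by
    have := Finset.min'_mem _ h
    rw [← hm] at this
    exact (Finset.mem_filter.1 this).2
  have hmU : ∀ u ∈ U, m ≤ u := fun u hu => by
    rw [hm]
    exact Finset.min'_le _ _ (Finset.mem_filter.2 ⟨Finset.mem_univ u, hUα u hu⟩)
  have hc : ∀ W, contractVec k e α W = if m ∈ W then 0 else vec k e α (insert m W) := by
    intro W
    rw [contractVec, dif_pos h, hm]
  have hcd : contract k e (diff k e (vec k e α U)) =
      ∑ t ∈ U, sign k U t • contractVec k e α (U.erase t) := by
    rw [diff_vec k hU, map_sum]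
    refine Finset.sum_congr rfl fun t _ => ?_
    rw [map_smul, contract_vec k ((sup_erase_le e U t).trans hU)]
  rw [hcd, contract_vec k hU, hc]
  by_cases hmem : m ∈ U
  · rw [if_pos hmem, map_zero, zero_add, Finset.sum_eq_single_of_mem m hmem, hc,
      if_neg (Finset.notMem_erase m U), Finset.insert_erase hmem, sign_eq_one hmU, one_smul]
    intro t _ htm
    rw [hc, if_pos (Finset.mem_erase.2 ⟨htm.symm, hmem⟩), smul_zero]
  · have hins : (insert m U).sup e ≤ α := by
      rw [Finset.sup_insert]
      exact sup_le hmα hU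
    rw [if_neg hmem, diff_vec k hins, Finset.sum_insert hmem, sign_insert_of_le le_rfl,
      sign_eq_one hmU, one_smul, Finset.erase_insert hmem, add_assoc, ← Finset.sum_add_distrib,
      Finset.sum_eq_zero, add_zero]
    intro t ht
    have htm : m ≠ t := fun h => hmem (h ▸ ht)
    rw [hc, if_neg fun h => hmem (Finset.mem_of_mem_erase h),
      sign_insert_of_lt hmem (lt_of_le_of_ne (hmU t ht) htm), Finset.erase_insert_of_ne htm,
      neg_smul, neg_add_cancel]

lemma diff_contract_single (U : Finset ι) (hne : U.Nonempty) (p : MvPolynomial σ k) :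
    diff k e (contract k e (Finsupp.single U p)) + contract k e (diff k e (Finsupp.single U p)) =
      Finsupp.single U p := by
  induction p using MvPolynomial.induction_on' with
  | monomial β c =>
    have : Finsupp.single U (monomial β c) = c • vec k e (β + U.sup e) U := by
      rw [vec, add_tsub_cancel_right, Finsupp.smul_single, smul_monomial, smul_eq_mul, mul_one]
    rw [this, map_smul, LinearMap.map_smul_of_tower, LinearMap.map_smul_of_tower, map_smul,
      ← smul_add, diff_contract_vec k le_add_self hne]
  | add p q hp hq =>
    rw [Finsupp.single_add, map_add, map_add, map_add, map_add, add_add_add_comm,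
      hp, hq]

end Homotopy

variable {k}

variable {e} in
lemma IsCard.diff {i : ℕ} {x : Finset ι →₀ MvPolynomial σ k} (hx : IsCard k (i + 1) x) :
    IsCard k i (diff k e x) := by
  rw [← Finsupp.sum_single x, Finsupp.sum, map_sum]
  refine IsCard.sum _ _ fun U hU => ?_
  rw [← mul_one (x U), ← smul_single_eq_single_mul, map_smul, diff_single_one]
  refine (IsCard.sum _ _ fun t ht => (IsCard.single ?_ _).smul _).smul _
  rw [Finset.card_erase_of_mem ht, hx U (Finsupp.mem_support_iff.1 hU), Nat.add_sub_cancel]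

section Exact

variable [Fintype ι]

variable {e} in
lemma IsCard.contractVec (α : σ →₀ ℕ) (U : Finset ι) :
    IsCard k (U.card + 1) (contractVec k e α U) := by
  rw [Taylor.contractVec]
  split_ifs with h h'
  · exact IsCard.zero _
  · exact IsCard.single (Finset.card_insert_of_notMem h') _
  · exact IsCard.zero _

variable {e} in
lemma IsCard.contract {i : ℕ} {x : Finset ι →₀ MvPolynomial σ k} (hx : IsCard k i x) :
    IsCard k (i + 1) (contract k e x) := by
  rw [← Finsupp.sum_single x, Finsupp.sum, map_sum]
  refine IsCard.sum _ _ fun U hU => ?_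
  rw [← hx U (Finsupp.mem_support_iff.1 hU), Taylor.contract, Finsupp.lsum_single,
    Module.Basis.constr_apply]
  exact IsCard.sum _ _ fun β _ => (IsCard.contractVec _ _).smul _

lemma diff_contract {i : ℕ} {x : Finset ι →₀ MvPolynomial σ k} (hx : IsCard k (i + 1) x) :
    Taylor.diff k e (Taylor.contract k e x) + Taylor.contract k e (Taylor.diff k e x) = x := by
  conv_rhs => rw [← Finsupp.sum_single x, Finsupp.sum]
  conv_lhs => rw [← Finsupp.sum_single x, Finsupp.sum]
  simp only [map_sum]
  rw [← Finset.sum_add_distrib]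
  refine Finset.sum_congr rfl fun U hU => diff_contract_single k e U ?_ _
  rw [← Finset.card_pos, hx U (Finsupp.mem_support_iff.1 hU)]
  exact Nat.succ_pos i

end Exact

end Taylor

/-! ### The Taylor complex as a graded free resolution. -/

section TaylorResolution

open MvPolynomial Taylor

variable {k : Type*} [Field k] {σ : Type*} {ι : Type}

/-- The inclusion of the `i`-th term of the Taylor complex into the sum of all terms. -/
def taylorIncl (k : Type*) [Field k] (σ : Type*) (ι : Type) (i : ℕ) :
    ({U : Finset ι // U.card = i} →₀ MvPolynomial σ k) →ₗ[MvPolynomial σ k]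
      (Finset ι →₀ MvPolynomial σ k) :=
  Finsupp.lmapDomain _ _ Subtype.val

lemma taylorIncl_injective (i : ℕ) : Function.Injective (taylorIncl k σ ι i) :=
  Finsupp.mapDomain_injective Subtype.val_injective

lemma taylorIncl_single {i : ℕ} (U : {U : Finset ι // U.card = i}) (p : MvPolynomial σ k) :
    taylorIncl k σ ι i (Finsupp.single U p) = Finsupp.single U.1 p :=
  Finsupp.mapDomain_single

lemma taylorIncl_apply {i : ℕ} (x : {U : Finset ι // U.card = i} →₀ MvPolynomial σ k) (U) :
    taylorIncl k σ ι i x U.1 = x U :=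
  Finsupp.mapDomain_apply Subtype.val_injective x U

lemma isCard_taylorIncl {i : ℕ} (x : {U : Finset ι // U.card = i} →₀ MvPolynomial σ k) :
    IsCard k i (taylorIncl k σ ι i x) := by
  intro U hU
  by_contra h
  refine hU (Finsupp.mapDomain_of_notMem_range x U ?_)
  rintro ⟨W, rfl⟩
  exact h W.2

/-- The projection of the sum of all terms of the Taylor complex to the `i`-th term. -/
def taylorProj (k : Type*) [Field k] (σ : Type*) (ι : Type) (i : ℕ) :
    (Finset ι →₀ MvPolynomial σ k) →ₗ[MvPolynomial σ k]
      ({U : Finset ι // U.card = i} →₀ MvPolynomial σ k) :=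
  Finsupp.lcomapDomain Subtype.val Subtype.val_injective

lemma taylorIncl_taylorProj {i : ℕ} {x : Finset ι →₀ MvPolynomial σ k} (hx : IsCard k i x) :
    taylorIncl k σ ι i (taylorProj k σ ι i x) = x := by
  ext1 U
  by_cases h : U.card = i
  · exact taylorIncl_apply _ ⟨U, h⟩
  · rw [not_imp_comm.1 (hx U) h, not_imp_comm.1 (isCard_taylorIncl _ U) h]

/-- The augmentation of the Taylor complex. -/
def taylorAug (I : Ideal (MvPolynomial σ k)) : ({U : Finset ι // U.card = 0} →₀ MvPolynomial σ k)
    →ₗ[MvPolynomial σ k] (MvPolynomial σ k ⧸ I) :=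
  Submodule.mkQ I ∘ₗ Finsupp.lapply ⟨∅, Finset.card_empty⟩

lemma taylorAug_apply (I : Ideal (MvPolynomial σ k)) (x) :
    taylorAug (ι := ι) I x = Ideal.Quotient.mk I (x ⟨∅, Finset.card_empty⟩) := rfl

lemma ext_card_zero {x y : {U : Finset ι // U.card = 0} →₀ MvPolynomial σ k}
    (h : x ⟨∅, Finset.card_empty⟩ = y ⟨∅, Finset.card_empty⟩) : x = y := by
  ext1 ⟨U, hU⟩
  obtain rfl := Finset.card_eq_zero.1 hU
  exact h

/-- The ideal generated by the monomials with exponents `e t`. -/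
def monomialIdeal (k : Type*) [Field k] {σ ι : Type*} (e : ι → σ →₀ ℕ) :
    Ideal (MvPolynomial σ k) :=
  Ideal.span (Set.range fun t => monomial (e t) 1)

/-- Every homogeneous element lifts to a homogeneous element of the zeroth term of the Taylor
resolution. -/
lemma exists_taylorAug_eq (e : ι → σ →₀ ℕ) (n : ℕ) (z : MvPolynomial σ k ⧸ monomialIdeal k e)
    (hz : z ∈ quotientGrading (monomialIdeal k e) n) :
    ∃ y : {U : Finset ι // U.card = 0} →₀ MvPolynomial σ k,
      IsHomogeneousVec (fun U => (U.1.sup e).degree) n y ∧ taylorAug (monomialIdeal k e) y = z := by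
  obtain ⟨p, hp, rfl⟩ := hz
  refine ⟨Finsupp.single ⟨∅, Finset.card_empty⟩ p, ?_, ?_⟩
  · rintro ⟨U, hU⟩
    obtain rfl := Finset.card_eq_zero.1 hU
    refine Or.inr ⟨n, ?_, ?_⟩
    · change (Finset.sup ∅ e).degree + n = n
      rw [Finset.sup_empty, bot_eq_zero, map_zero, zero_add]
    · rw [Finsupp.single_eq_same]
      exact hp
  · rw [taylorAug_apply, Finsupp.single_eq_same]
    rfl

variable [LinearOrder ι] (e : ι → σ →₀ ℕ)

/-- The differential of the Taylor complex. -/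
def taylorDiff (i : ℕ) : ({U : Finset ι // U.card = i + 1} →₀ MvPolynomial σ k)
    →ₗ[MvPolynomial σ k] ({U : Finset ι // U.card = i} →₀ MvPolynomial σ k) :=
  taylorProj k σ ι i ∘ₗ Taylor.diff k e ∘ₗ taylorIncl k σ ι (i + 1)

lemma taylorIncl_taylorDiff (i : ℕ) (x) : taylorIncl k σ ι i (taylorDiff e i x) =
    Taylor.diff k e (taylorIncl k σ ι (i + 1) x) :=
  taylorIncl_taylorProj (isCard_taylorIncl x).diff

lemma exact_taylorDiff [Fintype ι] (i : ℕ) :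
    Function.Exact (taylorDiff (k := k) e (i + 1)) (taylorDiff e i) := by
  intro y
  constructor
  · intro hy
    have h0 : Taylor.diff k e (taylorIncl k σ ι (i + 1) y) = 0 := by
      rw [← taylorIncl_taylorDiff, hy, map_zero]
    have h := diff_contract e (isCard_taylorIncl y)
    rw [h0, map_zero, add_zero] at h
    refine ⟨taylorProj k σ ι (i + 2) (contract k e (taylorIncl k σ ι (i + 1) y)),
      taylorIncl_injective _ ?_⟩
    rw [taylorIncl_taylorDiff, taylorIncl_taylorProj (isCard_taylorIncl y).contract, h]
  · rintro ⟨x, rfl⟩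
    apply taylorIncl_injective
    rw [taylorIncl_taylorDiff, taylorIncl_taylorDiff, diff_diff, map_zero]

lemma taylorDiff_zero_single (t : ι) (h) :
    taylorDiff (k := k) e 0 (Finsupp.single ⟨{t}, h⟩ 1) ⟨∅, Finset.card_empty⟩ =
      monomial (e t) 1 := by
  change Taylor.diff k e (taylorIncl k σ ι 1 _) ∅ = _
  rw [taylorIncl_single, diff_single_one, Finset.sum_singleton, Finset.sup_singleton,
    sign_eq_one (by simp), one_smul, vec, Finset.erase_singleton, Finsupp.single_eq_same,
    Finset.sup_empty, bot_eq_zero, tsub_zero]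

lemma exact_taylorAug :
    Function.Exact (taylorDiff (k := k) e 0) (taylorAug (monomialIdeal k e)) := by
  rw [LinearMap.exact_iff]
  apply le_antisymm
  · intro x hx
    rw [LinearMap.mem_ker, taylorAug_apply, Ideal.Quotient.eq_zero_iff_mem] at hx
    have hle : monomialIdeal k e ≤ Submodule.comap (Finsupp.lsingle ⟨∅, Finset.card_empty⟩)
        (LinearMap.range (taylorDiff (k := k) e 0)) := by
      refine Ideal.span_le.2 ?_
      rintro _ ⟨t, rfl⟩
      refine ⟨Finsupp.single ⟨{t}, Finset.card_singleton t⟩ 1, ext_card_zero ?_⟩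
      rw [taylorDiff_zero_single, Finsupp.lsingle_apply, Finsupp.single_eq_same]
    have := hle hx
    rw [Submodule.mem_comap, Finsupp.lsingle_apply] at this
    convert this
    exact ext_card_zero (by rw [Finsupp.single_eq_same])
  · rintro _ ⟨x, rfl⟩
    rw [LinearMap.mem_ker]
    suffices taylorAug (monomialIdeal k e) ∘ₗ taylorDiff (k := k) e 0 = 0 from
      LinearMap.congr_fun this x
    ext1 ⟨U, hU⟩
    obtain ⟨t, rfl⟩ := Finset.card_eq_one.1 hU
    ext1
    rw [LinearMap.comp_apply, LinearMap.comp_apply, Finsupp.lsingle_apply, taylorAug_apply,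
      taylorDiff_zero_single, LinearMap.zero_comp, LinearMap.zero_apply,
      Ideal.Quotient.eq_zero_iff_mem]
    exact Ideal.subset_span ⟨t, rfl⟩

lemma isHomogeneousVec_sum {B α : Type*} {deg : B → ℕ} {n : ℕ} (s : Finset α)
    (x : α → B →₀ MvPolynomial σ k) (h : ∀ a ∈ s, IsHomogeneousVec deg n (x a)) :
    IsHomogeneousVec deg n (∑ a ∈ s, x a) :=
  Finset.sum_induction x (IsHomogeneousVec deg n) (fun _ _ => isHomogeneousVec_add)
    (fun _ => Or.inl rfl) h

lemma isHomogeneousVec_diff (U : Finset ι) :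
    IsHomogeneousVec (fun W => (W.sup e).degree) (U.sup e).degree
      (Taylor.diff k e (Finsupp.single U 1)) := by
  rw [diff_single_one]
  refine isHomogeneousVec_sum _ _ fun t _ W => ?_
  rw [Finsupp.smul_apply, vec]
  by_cases h : U.erase t = W
  · subst h
    refine Or.inr ⟨(U.sup e - (U.erase t).sup e).degree, ?_, ?_⟩
    · rw [← map_add, add_tsub_cancel_of_le (sup_erase_le e U t)]
    · rw [Finsupp.single_eq_same, smul_monomial]
      exact isHomogeneous_monomial _ rfl
  · exact Or.inl (by rw [Finsupp.single_eq_of_ne (Ne.symm h), smul_zero])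

/-- The Taylor resolution of the quotient by a monomial ideal. -/
def taylorResolution (k : Type*) [Field k] [Fintype ι] :
    GradedFreeResolution (k := k) (σ := σ) (quotientGrading (monomialIdeal k e)) where
  B i := {U : Finset ι // U.card = i}
  finite_B _ := inferInstance
  deg _ U := (U.1.sup e).degree
  d := taylorDiff e
  ε := taylorAug _
  d_homogeneous i c b := by
    have := isHomogeneousVec_diff (k := k) e c.1 b.1
    rwa [← taylorIncl_single] at this
  ε_homogeneous := by
    rintro ⟨U, hU⟩
    obtain rfl := Finset.card_eq_zero.1 hU
    refine ⟨1, ?_, ?_⟩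
    · rw [Finset.sup_empty, bot_eq_zero, map_zero]
      exact isHomogeneous_one _ _
    · rw [taylorAug_apply, Finsupp.single_eq_same]
      rfl
  ε_surjective x := by
    obtain ⟨p, rfl⟩ := Ideal.Quotient.mk_surjective x
    exact ⟨Finsupp.single ⟨∅, Finset.card_empty⟩ p, by
      rw [taylorAug_apply, Finsupp.single_eq_same]⟩
  exact_zero := exact_taylorAug e
  exact_succ := exact_taylorDiff e

/-- The Taylor resolution is minimal if no generator can be left out of a least common multiple
without changing it. -/
lemma isMinimal_taylorResolution [Fintype ι]
    (he : ∀ (U : Finset ι), ∀ t ∈ U, (U.erase t).sup e ≠ U.sup e) :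
    (taylorResolution e k).IsMinimal := by
  suffices ∀ (i : ℕ) (c : {U : Finset ι // U.card = i + 1}) (b : {U : Finset ι // U.card = i}),
      constantCoeff (taylorDiff e i (Finsupp.single c (1 : MvPolynomial σ k)) b) = 0 from this
  rintro i ⟨U, hU⟩ ⟨W, hW⟩
  change constantCoeff (Taylor.diff k e (taylorIncl k σ ι (i + 1) _) W) = 0
  rw [taylorIncl_single, diff_single_one, Finsupp.finsetSum_apply, map_sum]
  refine Finset.sum_eq_zero fun t ht => ?_
  rw [Finsupp.smul_apply, vec]
  by_cases h : U.erase t = W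
  · classical
    rw [h, Finsupp.single_eq_same, smul_monomial, constantCoeff_monomial, if_neg]
    -- A nonzero constant term would mean that the quotient of the two least common multiples is 1.
    intro h0
    refine he U t ht (le_antisymm (sup_erase_le e U t) ?_)
    rw [h]
    exact tsub_eq_zero_iff_le.1 h0
  · rw [Finsupp.single_eq_of_ne (Ne.symm h), smul_zero, map_zero]

/-- If the Taylor resolution is minimal, the regularity of the quotient by a monomial ideal is
read off from the degrees of the least common multiples of the generators. -/
theorem regularity_monomialIdeal [Fintype ι]
    (he : ∀ (U : Finset ι), ∀ t ∈ U, (U.erase t).sup e ≠ U.sup e) (a : ℕ)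
    (hle : ∀ U : Finset ι, (U.sup e).degree ≤ a + U.card)
    (heq : ((Finset.univ : Finset ι).sup e).degree = a + Fintype.card ι) :
    regularity k σ (quotientGrading (monomialIdeal k e)) = ((a : ℝ) : EReal) := by
  apply le_antisymm
  · refine sSup_le ?_
    rintro r ⟨F, hF, i, j, hij, rfl⟩
    have h := hF.betti_ne_zero (taylorResolution e k) (exists_taylorAug_eq e) hij
    obtain ⟨⟨⟨U, hU⟩, hj⟩⟩ := (Nat.card_ne_zero.1 h).1
    have h1 := hle U
    change (U.sup e).degree = j at hj
    rw [hj, hU] at h1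
    rw [EReal.coe_le_coe_iff, sub_le_iff_le_add]
    exact_mod_cast h1
  -- The bound is attained by the set of all generators, in the last homological degree.
  · refine le_sSup ⟨taylorResolution e k, isMinimal_taylorResolution e he, Fintype.card ι,
      a + Fintype.card ι, ?_, by rw [Nat.cast_add, add_sub_cancel_right]⟩
    have := (taylorResolution e k).finite_B (Fintype.card ι)
    exact Nat.card_ne_zero.2 ⟨⟨⟨⟨Finset.univ, Finset.card_univ⟩, heq⟩⟩, inferInstance⟩

end TaylorResolution

universe u v in
/-- If the Taylor resolution is minimal, the projective dimension of the quotient by a monomial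
ideal is the number of generators. -/
theorem projectiveDimension_monomialIdeal {k : Type u} [Field k] {σ : Type v} {ι : Type}
    [LinearOrder ι] [Fintype ι] (e : ι → σ →₀ ℕ)
    (he : ∀ (U : Finset ι), ∀ t ∈ U, (U.erase t).sup e ≠ U.sup e) :
    CategoryTheory.projectiveDimension (ModuleCat.of (MvPolynomial σ k)
      (MvPolynomial σ k ⧸ monomialIdeal k e)) = Fintype.card ι := by
  refine (isMinimal_taylorResolution e he).projectiveDimension_eq
    ⟨⟨Finset.univ, Finset.card_univ⟩⟩ ⟨?_⟩
  rintro ⟨U, hU⟩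
  have := Finset.card_le_univ U
  omega

/-! ### Ideals generated by variables, and their heights -/

section Height

open MvPolynomial

variable (k : Type*) [Field k] {V : Type*}

open Classical in
/-- Setting the variables in `W` to zero. -/
def killVars (W : Set V) : MvPolynomial V k →ₐ[k] MvPolynomial V k :=
  aeval fun v => if v ∈ W then 0 else X v

/-- The prime ideal generated by the variables in `W`. -/
def varsIdeal (W : Set V) : Ideal (MvPolynomial V k) := RingHom.ker (killVars k W)

instance (W : Set V) : (varsIdeal k W).IsPrime := RingHom.ker_isPrime _

variable {k}

lemma X_mem_varsIdeal {W : Set V} {v : V} : X v ∈ varsIdeal k W ↔ v ∈ W := by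
  rw [varsIdeal, RingHom.mem_ker, killVars, aeval_X]
  split_ifs with h
  · simp [h]
  · simp [h, X_ne_zero]

/-- If J contains the variables in W, killing them does not change a polynomial modulo J. -/
lemma varsIdeal_le_iff {W : Set V} {J : Ideal (MvPolynomial V k)} :
    varsIdeal k W ≤ J ↔ ∀ v ∈ W, X v ∈ J := by
  refine ⟨fun h v hv => h (X_mem_varsIdeal.2 hv), fun h p hp => ?_⟩
  have key : (Ideal.Quotient.mkₐ k J).comp (killVars k W) = Ideal.Quotient.mkₐ k J := by
    ext v
    rw [AlgHom.comp_apply, killVars, aeval_X]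
    split_ifs with hv
    · rw [map_zero]
      exact (Ideal.Quotient.eq_zero_iff_mem.2 (h v hv)).symm
    · rfl
  have := AlgHom.congr_fun key p
  rw [AlgHom.comp_apply, show killVars k W p = 0 from hp, map_zero] at this
  exact Ideal.Quotient.eq_zero_iff_mem.1 this.symm

/-- Adding the variables one at a time gives a strict chain of primes. -/
lemma card_le_height_varsIdeal (W : Finset V) : (W.card : ℕ∞) ≤ (varsIdeal k (W : Set V)).height := by
  classical
  induction W using Finset.induction_on with
  | empty => simp
  | insert v W hv ih =>
    rw [Finset.card_insert_of_notMem hv, Nat.cast_add, Nat.cast_one]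
    refine (add_le_add_left ih 1).trans (Ideal.height_add_one_le_of_lt_of_isPrime ?_)
    refine lt_of_le_of_ne (varsIdeal_le_iff.2 fun w hw => X_mem_varsIdeal.2 (by simp_all)) ?_
    intro h
    have : (X v : MvPolynomial V k) ∈ varsIdeal k (W : Set V) := by
      rw [h]
      exact X_mem_varsIdeal.2 (by simp)
    exact hv (by simpa using X_mem_varsIdeal.1 this)

end Height

/-! ### Squarefree monomial ideals whose generators have private variables -/

section PrivateVariables

open MvPolynomial

variable {V : Type*}

/-- The exponent of a squarefree monomial. -/
def sqfreeExp (s : Finset V) : V →₀ ℕ := ∑ y ∈ s, Finsupp.single y 1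

lemma sqfreeExp_apply [DecidableEq V] (s : Finset V) (v : V) :
    sqfreeExp s v = if v ∈ s then 1 else 0 := by
  rw [sqfreeExp, Finsupp.finsetSum_apply]
  simp [Finsupp.single_apply]

lemma degree_sqfreeExp (s : Finset V) : (sqfreeExp s).degree = s.card := by
  rw [sqfreeExp, map_sum]
  simp

lemma monomial_sqfreeExp (k : Type*) [Field k] (s : Finset V) :
    monomial (sqfreeExp s) (1 : k) = ∏ y ∈ s, X y := by
  rw [sqfreeExp, monomial_sum_one]
  rfl

lemma sup_sqfreeExp [DecidableEq V] {ι : Type*} (N : ι → Finset V) (U : Finset ι) :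
    (U.sup fun t => sqfreeExp (N t)) = sqfreeExp (U.biUnion N) := by
  classical
  induction U using Finset.induction_on with
  | empty => rw [Finset.sup_empty, Finset.biUnion_empty, sqfreeExp, Finset.sum_empty, bot_eq_zero]
  | insert t U _ ih =>
    rw [Finset.sup_insert, ih, Finset.biUnion_insert]
    ext v
    rw [Finsupp.sup_apply, sqfreeExp_apply, sqfreeExp_apply, sqfreeExp_apply]
    by_cases h1 : v ∈ N t <;> by_cases h2 : v ∈ U.biUnion N <;>
      simp only [h1, h2, Finset.mem_union, if_true, if_false, or_true, or_false] <;> decide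

variable {k : Type*} [Field k] {ι : Type*} {N : ι → Finset V} {τ : ι → V}

/-- The hypothesis `hτ` makes `τ t` a private variable of the generator t, so it leaves the least
common multiple together with t. -/
lemma erase_sup_sqfreeExp_ne [LinearOrder ι] (hτ : ∀ s t, τ s ∈ N t ↔ s = t) (U : Finset ι)
    (t : ι) (ht : t ∈ U) :
    ((U.erase t).sup fun t => sqfreeExp (N t)) ≠ U.sup fun t => sqfreeExp (N t) := by
  classical
  rw [sup_sqfreeExp, sup_sqfreeExp]
  intro h
  have := DFunLike.congr_fun h (τ t)
  rw [sqfreeExp_apply, sqfreeExp_apply, if_neg, if_pos] at this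
  · exact zero_ne_one this
  · exact Finset.mem_biUnion.2 ⟨t, ht, (hτ t t).2 rfl⟩
  · rw [Finset.mem_biUnion]
    rintro ⟨s, hs, hts⟩
    exact (Finset.mem_erase.1 hs).1 ((hτ t s).1 hts).symm

lemma injective_of_mem_iff (hτ : ∀ s t, τ s ∈ N t ↔ s = t) : Function.Injective τ :=
  fun s t h => (hτ s t).1 (h ▸ (hτ t t).2 rfl)

/-- The lcm over U involves only the private variables of U itself and the a variables that are
private to no generator. -/
lemma degree_sup_sqfreeExp_le [Fintype V] [Fintype ι] (hτ : ∀ s t, τ s ∈ N t ↔ s = t) {a : ℕ}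
    (ha : a + Fintype.card ι = Fintype.card V) (U : Finset ι) :
    (U.sup fun t => sqfreeExp (N t)).degree ≤ a + U.card := by
  classical
  rw [sup_sqfreeExp, degree_sqfreeExp]
  have hinj := injective_of_mem_iff hτ
  have hsub : U.biUnion N ⊆ U.image τ ∪ (Finset.univ.image τ)ᶜ := by
    intro v hv
    obtain ⟨t, ht, hvt⟩ := Finset.mem_biUnion.1 hv
    by_cases h : v ∈ Finset.univ.image τ
    · obtain ⟨s, -, rfl⟩ := Finset.mem_image.1 h
      obtain rfl := (hτ s t).1 hvt
      exact Finset.mem_union_left _ (Finset.mem_image_of_mem τ ht)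
    · exact Finset.mem_union_right _ (Finset.mem_compl.2 h)
  refine (Finset.card_le_card hsub).trans ((Finset.card_union_le _ _).trans ?_)
  rw [Finset.card_compl, Finset.card_image_of_injective _ hinj,
    Finset.card_image_of_injective _ hinj, Finset.card_univ]
  omega

lemma degree_sup_sqfreeExp_univ [Fintype V] [Fintype ι] (hN : ∀ v, ∃ t, v ∈ N t) :
    ((Finset.univ : Finset ι).sup fun t => sqfreeExp (N t)).degree = Fintype.card V := by
  classical
  rw [sup_sqfreeExp, degree_sqfreeExp, ← Finset.card_univ]
  congr 1
  ext v
  simpa using hN v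

lemma bigHeight_monomialIdeal [Fintype V] [Fintype ι] (hτ : ∀ s t, τ s ∈ N t ↔ s = t) :
    bigHeight (monomialIdeal k fun t => sqfreeExp (N t)) = Fintype.card ι := by
  classical
  apply le_antisymm
  · refine iSup₂_le fun P hP => ?_
    refine (Ideal.height_le_card_of_mem_minimalPrimes_span (Set.finite_range _) hP).trans ?_
    rw [Nat.cast_le, ← Set.image_univ]
    exact (Set.ncard_image_le Set.finite_univ).trans
      (by rw [Set.ncard_univ, Nat.card_eq_fintype_card])
  · refine le_trans ?_ (le_iSup₂ (varsIdeal k (Finset.univ.image τ : Finset V)) ?_)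
    · refine le_trans ?_ (card_le_height_varsIdeal _)
      rw [Finset.card_image_of_injective _ (injective_of_mem_iff hτ), Finset.card_univ]
    · refine ⟨⟨inferInstance, Ideal.span_le.2 ?_⟩, ?_⟩
      · rintro _ ⟨t, rfl⟩
        dsimp only
        rw [monomial_sqfreeExp]
        exact Ideal.mem_of_dvd _ (Finset.dvd_prod_of_mem _ ((hτ t t).2 rfl))
          (X_mem_varsIdeal.2 (by simp))
      · rintro Q ⟨hQ, hIQ⟩ hle
        refine varsIdeal_le_iff.2 fun v hv => ?_
        obtain ⟨t, -, rfl⟩ := Finset.mem_image.1 (Finset.mem_coe.1 hv)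
        have hmem : ∏ y ∈ N t, X y ∈ Q := by
          rw [← monomial_sqfreeExp]
          exact hIQ (Ideal.subset_span ⟨t, rfl⟩)
        -- A prime Q below contains some variable of the generator t. That variable is private to
        -- some generator, hence it is `τ t`.
        obtain ⟨y, hy, hyQ⟩ := (hQ.prod_mem_iff).1 hmem
        obtain ⟨s, -, rfl⟩ := Finset.mem_image.1 (Finset.mem_coe.1 (X_mem_varsIdeal.1 (hle hyQ)))
        rwa [← (hτ s t).1 hy]

end PrivateVariables

/-! ### A vertex cover by vertices with a private leaf -/

section Cover

variable {V : Type*} {G : SimpleGraph V}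

lemma mem_V₁_iff {x : V} : x ∈ V₁ G ↔ ∃ y, G.neighborSet x = {y} := Set.ncard_eq_one

lemma notMem_V₁_of_two_le {x : V} (h : 2 ≤ deg G x) : x ∉ V₁ G := by
  intro h'
  have : deg G x = 1 := h'
  omega

lemma neighborSet_eq_of_mem_V₁ {x y : V} (hx : x ∈ V₁ G) (h : G.Adj x y) :
    G.neighborSet x = {y} := by
  obtain ⟨z, hz⟩ := mem_V₁_iff.1 hx
  have : y ∈ G.neighborSet x := h
  rw [hz, Set.mem_singleton_iff] at this
  rw [hz, this]

lemma mem_V₁'_of_adj {x y : V} (hx : x ∈ V₁ G) (hy : y ∈ V₁ G) (h : G.Adj x y) : x ∈ V₁' G := by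
  refine ⟨hx, ?_⟩
  rw [neighborSet_eq_of_mem_V₁ hx h]
  exact Set.singleton_subset_iff.2 hy

lemma disjoint_V₂_V₁' : Disjoint (V₂ G) (V₁' G) :=
  Set.disjoint_left.2 fun _ h h' => notMem_V₁_of_two_le h.1 h'.1

lemma matchingNumber_eq_card {S : Finset V} (hS : ∀ x y, G.Adj x y → x ∈ S ∨ y ∈ S)
    (hleaf : ∀ s ∈ S, ∃ t ∉ S, G.neighborSet t = {s}) : matchingNumber G = S.card := by
  classical
  refine IsGreatest.csSup_eq ⟨?_, ?_⟩
  · choose! l hlS hl using hleaf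
    have hadj : ∀ s ∈ S, G.Adj s (l s) := fun s hs => by
      have : s ∈ G.neighborSet (l s) := by rw [hl s hs]; rfl
      exact G.adj_symm this
    have hinj : ∀ s ∈ S, ∀ s' ∈ S, ∀ v, v ∈ s(s, l s) → v ∈ s(s', l s') → s = s' := by
      intro s hs s' hs' v hv hv'
      rw [Sym2.mem_iff] at hv hv'
      rcases hv with rfl | rfl <;> rcases hv' with h | h
      · exact h
      · exact absurd (h ▸ hs) (hlS s' hs')
      · exact absurd (h ▸ hs') (hlS s hs)
      · exact Set.singleton_injective (by rw [← hl s hs, ← hl s' hs', h])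
    refine ⟨S.image fun s => s(s, l s), ⟨?_, ?_⟩, Finset.card_image_of_injOn ?_⟩
    · intro e he
      obtain ⟨s, hs, rfl⟩ := Finset.mem_image.1 he
      exact hadj s hs
    · intro e he f hf hef v hv
      obtain ⟨s, hs, rfl⟩ := Finset.mem_image.1 he
      obtain ⟨s', hs', rfl⟩ := Finset.mem_image.1 hf
      exact hef (by rw [hinj s hs s' hs' v hv.1 hv.2])
    · intro s hs s' hs' h
      dsimp only at h
      exact hinj s hs s' hs' s (Sym2.mem_mk_left _ _) (h ▸ Sym2.mem_mk_left _ _)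
  · rintro _ ⟨M, ⟨hM, hdisj⟩, rfl⟩
    have hex : ∀ e ∈ M, ∃ v ∈ S, v ∈ e := by
      intro e he
      have := hM e he
      induction e using Sym2.ind with
      | h x y =>
        rcases hS x y this with h | h
        · exact ⟨x, h, Sym2.mem_mk_left _ _⟩
        · exact ⟨y, h, Sym2.mem_mk_right _ _⟩
    refine Finset.card_le_card_of_forall_subsingleton (fun e v => v ∈ e) (by simpa using hex) ?_
    rintro v - e ⟨he, hve⟩ f ⟨hf, hvf⟩
    by_contra hne
    exact hdisj e he f hf hne v ⟨hve, hvf⟩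

variable [Fintype V]

lemma mem_V₁_or_mem_V₂_or_mem_V₃ {x y : V} (h : G.Adj x y) :
    x ∈ V₁ G ∨ x ∈ V₂ G ∨ x ∈ V₃ G := by
  have h1 : 0 < deg G x := (Set.ncard_pos (Set.toFinite _)).2 ⟨y, h⟩
  by_cases h2 : deg G x = 1
  · exact Or.inl h2
  · rcases Set.eq_empty_or_nonempty (G.neighborSet x ∩ V₁ G) with h3 | h3
    · exact Or.inr (Or.inr ⟨by omega, h3⟩)
    · exact Or.inr (Or.inl ⟨by omega, h3⟩)

/-- The smaller end points of the connected components with two vertices. -/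
def lowerEnds [LinearOrder V] (G : SimpleGraph V) : Set V :=
  {x | x ∈ V₁' G ∧ ∃ y, G.Adj x y ∧ x < y}

/-- Passing to the only neighbour is an involution of `V₁' G` without fixed points, and `lowerEnds
G` picks one point of each orbit. -/
lemma ncard_V₁' [LinearOrder V] : (V₁' G).ncard = 2 * (lowerEnds G).ncard := by
  have hex : ∀ x, ∃ y, x ∈ V₁' G → G.neighborSet x = {y} := fun x => by
    by_cases h : x ∈ V₁' G
    · obtain ⟨y, hy⟩ := mem_V₁_iff.1 h.1
      exact ⟨y, fun _ => hy⟩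
    · exact ⟨x, fun h' => absurd h' h⟩
  choose p hp using hex
  have hadj : ∀ x ∈ V₁' G, G.Adj x (p x) := fun x hx => by
    change p x ∈ G.neighborSet x
    rw [hp x hx]; rfl
  have hmem : ∀ x ∈ V₁' G, p x ∈ V₁' G := fun x hx =>
    mem_V₁'_of_adj (hx.2 (hadj x hx)) hx.1 (hadj x hx).symm
  have hpp : ∀ x ∈ V₁' G, p (p x) = x := fun x hx => by
    have := (hadj x hx).symm
    rw [← SimpleGraph.mem_neighborSet, hp _ (hmem x hx)] at this
    exact this.symm
  have hlow : ∀ x, x ∈ lowerEnds G ↔ x ∈ V₁' G ∧ x < p x := fun x => by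
    refine and_congr_right fun hx => ⟨?_, fun h => ⟨p x, hadj x hx, h⟩⟩
    rintro ⟨y, hxy, hlt⟩
    rw [← SimpleGraph.mem_neighborSet, hp x hx] at hxy
    rwa [← Set.mem_singleton_iff.1 hxy]
  have hunion : V₁' G = lowerEnds G ∪ p '' lowerEnds G := by
    ext x
    constructor
    · intro hx
      rcases lt_or_gt_of_ne (hadj x hx).ne with h | h
      · exact Or.inl ((hlow x).2 ⟨hx, h⟩)
      · exact Or.inr ⟨p x, (hlow _).2 ⟨hmem x hx, by rwa [hpp x hx]⟩, hpp x hx⟩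
    · rintro (h | ⟨y, hy, rfl⟩)
      · exact h.1
      · exact hmem y hy.1
  have hdisj : Disjoint (lowerEnds G) (p '' lowerEnds G) := by
    refine Set.disjoint_left.2 ?_
    rintro _ hx ⟨y, hy, rfl⟩
    have h1 := ((hlow _).1 hx).2
    rw [hpp y hy.1] at h1
    exact lt_asymm h1 ((hlow _).1 hy).2
  have hinj : Set.InjOn p (lowerEnds G) := fun x hx y hy h => by
    rw [← hpp x hx.1, h, hpp y hy.1]
  rw [hunion, Set.ncard_union_eq hdisj (Set.toFinite _) (Set.toFinite _),
    hinj.ncard_image, two_mul]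

variable (G) in
lemma exists_cover_with_private_leaves (hG : G.IsIndepSet (V₃ G)) :
    ∃ S : Finset V, (∀ x y, G.Adj x y → x ∈ S ∨ y ∈ S) ∧
      (∀ s ∈ S, ∃ t ∉ S, G.neighborSet t = {s}) ∧
      (S.card : ℚ) = (V₂ G).ncard + (1 / 2 : ℚ) * (V₁' G).ncard := by
  classical
  -- Any linear order will do; it serves only to choose an end of each two-vertex component.
  let : LinearOrder V := linearOrderOfSTO (WellOrderingRel (α := V))
  refine ⟨(V₂ G ∪ lowerEnds G).toFinset, fun x y h => ?_, fun s hs => ?_, ?_⟩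
  · simp only [Set.mem_toFinset]
    rcases mem_V₁_or_mem_V₂_or_mem_V₃ h with hx | hx | hx
    · rcases mem_V₁_or_mem_V₂_or_mem_V₃ h.symm with hy | hy | hy
      · rcases lt_or_gt_of_ne h.ne with hlt | hlt
        · exact Or.inl (Or.inr ⟨mem_V₁'_of_adj hx hy h, y, h, hlt⟩)
        · exact Or.inr (Or.inr ⟨mem_V₁'_of_adj hy hx h.symm, x, h.symm, hlt⟩)
      · exact Or.inr (Or.inl hy)
      · exact absurd hy.2 (Set.Nonempty.ne_empty ⟨x, h.symm, hx⟩)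
    · exact Or.inl (Or.inl hx)
    · rcases mem_V₁_or_mem_V₂_or_mem_V₃ h.symm with hy | hy | hy
      · exact absurd hx.2 (Set.Nonempty.ne_empty ⟨y, h, hy⟩)
      · exact Or.inr (Or.inl hy)
      -- The only use of the independence of `V₃ G`: other edges meet `V₂ G` or join two leaves.
      · exact absurd h (hG hx hy h.ne)
  · simp only [Set.mem_toFinset] at hs ⊢
    rcases hs with hs | ⟨hs, y, hsy, hlt⟩
    · obtain ⟨t, hst, ht⟩ := hs.2
      refine ⟨t, ?_, neighborSet_eq_of_mem_V₁ ht (G.adj_symm hst)⟩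
      rintro (h | h)
      · exact notMem_V₁_of_two_le h.1 ht
      · exact notMem_V₁_of_two_le hs.1 (h.1.2 (G.adj_symm hst))
    · have hy := hs.2 hsy
      have hny := neighborSet_eq_of_mem_V₁ hy hsy.symm
      refine ⟨y, ?_, hny⟩
      rintro (h | ⟨-, z, hyz, hlt'⟩)
      · exact notMem_V₁_of_two_le h.1 hy
      · rw [← SimpleGraph.mem_neighborSet, hny, Set.mem_singleton_iff] at hyz
        subst hyz
        exact lt_asymm hlt hlt'
  · rw [← Set.ncard_eq_toFinset_card', Set.ncard_union_eq
      (disjoint_V₂_V₁'.mono_right fun x hx => hx.1) (Set.toFinite _) (Set.toFinite _), ncard_V₁']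
    push_cast
    ring

lemma mem_closedNbhd {x y : V} : y ∈ closedNbhd G x ↔ y = x ∨ G.Adj x y := by
  simp [closedNbhd]

/-- The closed neighborhood of the leaf at s is contained in that of s, so the generator of s is
redundant. -/
lemma NI_eq_monomialIdeal (k : Type*) [Field k] {S : Finset V} {ι : Type*} (τ : ι → V)
    (hτ : ∀ v, v ∉ S → v ∈ Set.range τ)
    (hleaf : ∀ s ∈ S, ∃ t ∉ S, G.neighborSet t = {s}) :
    NI k G = monomialIdeal k fun t => sqfreeExp (closedNbhd G (τ t)) := by
  apply le_antisymm
  · refine Ideal.span_le.2 ?_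
    rintro _ ⟨x, rfl⟩
    obtain ⟨t, ht⟩ : ∃ t, closedNbhd G (τ t) ⊆ closedNbhd G x := by
      by_cases hx : x ∈ S
      · obtain ⟨y, hy, hyx⟩ := hleaf x hx
        obtain ⟨t, rfl⟩ := hτ y hy
        refine ⟨t, fun z hz => ?_⟩
        have hadj : x ∈ G.neighborSet (τ t) := by rw [hyx]; rfl
        rcases mem_closedNbhd.1 hz with rfl | hz
        · exact mem_closedNbhd.2 (Or.inr (G.adj_symm hadj))
        · rw [← SimpleGraph.mem_neighborSet, hyx] at hz
          exact mem_closedNbhd.2 (Or.inl hz)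
      · obtain ⟨t, rfl⟩ := hτ x hx
        exact ⟨t, subset_rfl⟩
    refine Ideal.mem_of_dvd _ (Finset.prod_dvd_prod_of_subset _ _ _ ht) ?_
    rw [← monomial_sqfreeExp]
    exact Ideal.subset_span ⟨t, rfl⟩
  · refine Ideal.span_le.2 ?_
    rintro _ ⟨t, rfl⟩
    dsimp only
    rw [monomial_sqfreeExp]
    exact Ideal.subset_span ⟨τ t, rfl⟩

end Cover

end ClosedNbhd

end

open ClosedNbhd in
theorem theorem2p6 {k : Type*} [Field k] {V : Type*} [Fintype V] (G : SimpleGraph V)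
    (hG : G.IsIndepSet (ClosedNbhd.V₃ G)) :
    (ClosedNbhd.matchingNumber G : ℚ) =
        (ClosedNbhd.V₂ G).ncard + (1 / 2 : ℚ) * (ClosedNbhd.V₁' G).ncard ∧
      ClosedNbhd.regularity k V (ClosedNbhd.quotientGrading (ClosedNbhd.NI k G)) =
        ((ClosedNbhd.matchingNumber G : ℝ) : EReal) ∧
      CategoryTheory.projectiveDimension
          (ModuleCat.of (MvPolynomial V k) (MvPolynomial V k ⧸ ClosedNbhd.NI k G)) =
        ((Fintype.card V - ClosedNbhd.matchingNumber G : ℕ) : WithBot ℕ∞) ∧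
      ClosedNbhd.bigHeight (ClosedNbhd.NI k G) =
        ((Fintype.card V - ClosedNbhd.matchingNumber G : ℕ) : ℕ∞) := by
  classical
  obtain ⟨S, hS, hleaf, hcard⟩ := exists_cover_with_private_leaves G hG
  rw [matchingNumber_eq_card hS hleaf]
  refine ⟨hcard, ?_⟩
  -- The vertices outside S are indexed by `Fin`, since the Taylor resolution needs a linearly
  -- ordered index type in `Type`.
  let τ : Fin Sᶜ.card → V := fun i => (Sᶜ.equivFin.symm i).1
  have hτS : ∀ i, τ i ∉ S := fun i => Finset.mem_compl.1 (Sᶜ.equivFin.symm i).2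
  have hτinj : Function.Injective τ := Subtype.val_injective.comp Sᶜ.equivFin.symm.injective
  have hτsurj : ∀ v, v ∉ S → v ∈ Set.range τ := fun v hv =>
    ⟨Sᶜ.equivFin ⟨v, Finset.mem_compl.2 hv⟩, by simp [τ]⟩
  have hτ : ∀ s t, τ s ∈ closedNbhd G (τ t) ↔ s = t := by
    intro s t
    rw [mem_closedNbhd]
    refine ⟨?_, fun h => Or.inl (congrArg τ h)⟩
    rintro (h | h)
    · exact hτinj h
    -- The complement of a vertex cover is independent.
    · exact absurd (hS _ _ h) (by simp [hτS])
  have hN : ∀ v, ∃ t, v ∈ closedNbhd G (τ t) := by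
    intro v
    by_cases hv : v ∈ S
    · obtain ⟨y, hy, hyv⟩ := hleaf v hv
      obtain ⟨t, rfl⟩ := hτsurj y hy
      refine ⟨t, mem_closedNbhd.2 (Or.inr ?_)⟩
      have : v ∈ G.neighborSet (τ t) := by rw [hyv]; rfl
      exact this
    · obtain ⟨t, rfl⟩ := hτsurj v hv
      exact ⟨t, mem_closedNbhd.2 (Or.inl rfl)⟩
  have hι : S.card + Fintype.card (Fin Sᶜ.card) = Fintype.card V := by
    rw [Fintype.card_fin, Finset.card_add_card_compl]
  have hsub : Fintype.card V - S.card = Fintype.card (Fin Sᶜ.card) := by omega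
  rw [NI_eq_monomialIdeal k τ hτsurj hleaf, hsub]
  exact ⟨regularity_monomialIdeal _ (erase_sup_sqfreeExp_ne hτ) S.card
    (degree_sup_sqfreeExp_le hτ hι) ((degree_sup_sqfreeExp_univ hN).trans hι.symm),
    projectiveDimension_monomialIdeal _ (erase_sup_sqfreeExp_ne hτ), bigHeight_monomialIdeal hτ⟩
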